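/- Let $E=(E^0,E^1,r,s)$ be a directed graph with finite vertex set $E^0$ (the edge set $E^1$ may be infinite), let $\mathcal A$ be an alphabet and let $\mathcal L:E^1\to\mathcal A$ be a labelling map that is left resolving: two edges with the same range and the same label are equal. Finite paths are sequences $\lambda_1\cdots\lambda_n$ of edges with $r(\lambda_i)=s(\lambda_{i+1})$, vertices being the paths of length $0$ (with label the empty word $\omega$); $\mathcal L$ extends to paths letter by letter. Let $\mathcal L^*$ be the set of labels of finite paths together with $\omega$, and for $A\subseteq E^0$ and $\alpha\in\mathcal L^*$ let $r(A,\alpha)$ be the set of ranges of the finite paths with label $\alpha$ and source in $A$ (so $r(A,\omega)=A$), and $r(\alpha)=r(E^0,\alpha)$. Let $S$ be the inverse semigroup of the labelled space $(E,\mathcal L,\mathcal P(E^0))$. It consists of an element $0$ and of the triples $(\alpha,A,\beta)$ with $\alpha,\beta\in\mathcal L^*$ and $\emptyset\neq A\subseteq r(\alpha)\cap r(\beta)$, with product $$(\alpha,A,\beta)(\gamma,B,\delta)=\begin{cases}(\alpha\gamma',\,r(A,\gamma')\cap B,\,\delta)&\text{if }\gamma=\beta\gamma',\\(\alpha,\,A\cap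 r(B,\beta'),\,\delta\beta')&\text{if }\beta=\gamma\beta',\\0&\text{otherwise,}\end{cases}$$ where a triple with empty middle entry is read as $0$, and every product with a factor $0$ is $0$. Its set $E(S)$ of idempotents is a meet semilattice with least element $0$, where $p\wedge q=pq$ and $p\le q$ means $pq=p$. A character of $E(S)$ is a nonzero map $\phi:E(S)\to\{0,1\}$ with $\phi(0)=0$ and $\phi(p\wedge q)=\phi(p)\wedge\phi(q)$. It is tight if $\bigvee_{z\in Z}\phi(z)=\phi(x)$ for every $x\in E(S)$ and every finite cover $Z$ of $x$, that is, every finite $Z\subseteq\{y: y\le x\}$ such that each nonzero $y\le x$ satisfies $z\wedge y\neq0$ for some $z\in Z$. The tight spectrum of $E(S)$ is the set of tight characters with the topology of pointwise convergence. The boundary path space $\partial E$ consists of all infinite paths of $E$ and of those finite paths whose range is singular, i.e. a vertex that emits no edge or infinitely many edges. Its topology is the initial topology for the map $\partial E\to\{0,1\}^{E^*}$ that sends $\lambda$ to the indicator function of the set of its beginnings in the set $E^*$ of finite paths (a vertex being a beginning of the paths with that source), where $\{0,1\}^{E^*}$ carries the product topology. Then the tight spectrum of $E(S)$ is homeomorphic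 to $\partial E$. -/

import Mathlib

/-! ### Directed graphs, paths and the boundary path space -/

/-- A directed graph with vertex set `V` and edge set `E`. -/
structure DirectedGraph (V E : Type*) where
  source : E → V
  range : E → V

namespace DirectedGraph

variable {V E : Type*}

/-- `l` is a sequence of consecutive edges whose first edge (if any) has source `v`. -/
def IsPathFrom (G : DirectedGraph V E) : V → List E → Prop
  | _, [] => True
  | v, e :: l => G.source e = v ∧ G.IsPathFrom (G.range e) l

/-- The vertex at which a path with source `v` and edges `l` ends. -/
def endpoint (G : DirectedGraph V E) (v : V) (l : List E) : V :=
  l.foldl (fun _ e => G.range e) v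

/-- Finite paths. The paths of length `0` are the vertices; for a path of positive length the
field `source` is the source of its first edge. -/
@[ext]
structure FinPath (G : DirectedGraph V E) where
  source : V
  edges : List E
  isPath : G.IsPathFrom source edges

/-- The range of a finite path. -/
def FinPath.range {G : DirectedGraph V E} (p : G.FinPath) : V :=
  G.endpoint p.source p.edges

/-- Infinite paths. -/
@[ext]
structure InfPath (G : DirectedGraph V E) where
  edge : ℕ → E
  isPath : ∀ i, G.range (edge i) = G.source (edge (i + 1))

/-- All paths, finite or infinite. -/
inductive AnyPath (G : DirectedGraph V E) where
  | fin (p : G.FinPath) : AnyPath G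
  | inf (p : G.InfPath) : AnyPath G

/-- The finite path `m` is a beginning of a path. -/
def IsBeginning {G : DirectedGraph V E} (m : G.FinPath) : G.AnyPath → Prop
  | .fin p => m.source = p.source ∧ m.edges <+: p.edges
  | .inf p => m.source = G.source (p.edge 0) ∧
      ∀ (i : ℕ) (hi : i < m.edges.length), m.edges[i] = p.edge i

open Classical in
/-- The indicator function of the set of finite beginnings of a path. -/
noncomputable def beginnings {G : DirectedGraph V E} (p : G.AnyPath) : G.FinPath → Bool :=
  fun m => decide (IsBeginning m p)

/-- The initial topology for `beginnings`, where `{0,1}` to the power of the set of finite paths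
carries the product topology. -/
noncomputable instance (G : DirectedGraph V E) : TopologicalSpace G.AnyPath :=
  TopologicalSpace.induced beginnings inferInstance

/-- A vertex is singular if it is a sink or an infinite emitter. -/
def IsSingular (G : DirectedGraph V E) (v : V) : Prop :=
  {e | G.source e = v} = ∅ ∨ {e | G.source e = v}.Infinite

/-- The boundary path space: infinite paths, and finite paths ending in a singular vertex. -/
def boundaryPathSpace (G : DirectedGraph V E) : Set G.AnyPath :=
  {x | match x with
    | .fin p => G.IsSingular p.range
    | .inf _ => True}

end DirectedGraph

/-! ### Labelled graphs and labelled spaces -/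

/-- A labelled graph over the alphabet `L`. -/
structure LabelledGraph (V E L : Type*) extends DirectedGraph V E where
  label : E → L

namespace LabelledGraph

variable {V E L : Type*}

/-- The word `w` is the label of the finite path `p`. -/
def IsRepresentative (G : LabelledGraph V E L) (p : G.FinPath) (w : List L) : Prop :=
  p.edges.map G.label = w

/-- Labelled paths of finite length, including the empty word. -/
def IsLabelledPath (G : LabelledGraph V E L) (w : List L) : Prop :=
  w = [] ∨ ∃ p : G.FinPath, G.IsRepresentative p w

/-- The relative range of the word `w` with respect to `A`. For the empty word it is `A`. -/
def relRange (G : LabelledGraph V E L) (A : Set V) (w : List L) : Set V :=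
  {v | ∃ p : G.FinPath, G.IsRepresentative p w ∧ p.source ∈ A ∧ p.range = v}

/-- The range of a word. -/
def wordRange (G : LabelledGraph V E L) (w : List L) : Set V := G.relRange Set.univ w

/-- Two edges with the same range and the same label are equal. -/
class LeftResolving (G : LabelledGraph V E L) : Prop where
  eq_of_range_eq : ∀ e f : E, G.range e = G.range f → G.label e = G.label f → e = f

theorem mem_relRange_nil (G : LabelledGraph V E L) {A : Set V} {v : V} :
    v ∈ G.relRange A [] ↔ v ∈ A := by
  constructor
  · rintro ⟨p, hp, hA, rfl⟩
    have : p.edges = [] := by simpa [IsRepresentative] using hp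
    simpa [DirectedGraph.FinPath.range, DirectedGraph.endpoint, this] using hA
  · intro h
    exact ⟨⟨v, [], trivial⟩, rfl, h, rfl⟩

theorem relRange_nil (G : LabelledGraph V E L) (A : Set V) : G.relRange A [] = A :=
  Set.ext fun _ => G.mem_relRange_nil

theorem mem_relRange_cons (G : LabelledGraph V E L) {A : Set V} {a : L} {w : List L} {v : V} :
    v ∈ G.relRange A (a :: w) ↔
      ∃ e, G.source e ∈ A ∧ G.label e = a ∧ v ∈ G.relRange {G.range e} w := by
  constructor
  · rintro ⟨⟨u, l, hl⟩, hp, hA, rfl⟩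
    cases l with
    | nil => simp [IsRepresentative] at hp
    | cons e l =>
      simp only [IsRepresentative, List.map_cons, List.cons.injEq] at hp
      obtain ⟨h1, h2⟩ := hl
      exact ⟨e, by rw [h1]; exact hA, hp.1, ⟨⟨_, l, h2⟩, hp.2, rfl, rfl⟩⟩
  · rintro ⟨e, hA, rfl, ⟨⟨u, l, hl⟩, hp, hu, rfl⟩⟩
    have hu : u = G.range e := hu
    subst hu
    exact ⟨⟨G.source e, e :: l, rfl, hl⟩, by
      simp only [IsRepresentative] at hp ⊢; simp [hp], hA, rfl⟩

theorem mem_relRange_iff_singleton (G : LabelledGraph V E L) {A : Set V} {w : List L} {v : V} :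
    v ∈ G.relRange A w ↔ ∃ u ∈ A, v ∈ G.relRange {u} w := by
  constructor
  · rintro ⟨p, hp, hA, hv⟩
    exact ⟨_, hA, p, hp, rfl, hv⟩
  · rintro ⟨u, hu, p, hp, hA, hv⟩
    have hA : p.source = u := hA
    exact ⟨p, hp, by rw [hA]; exact hu, hv⟩

theorem relRange_mono (G : LabelledGraph V E L) {A B : Set V} (h : A ⊆ B) (w : List L) :
    G.relRange A w ⊆ G.relRange B w := by
  rintro v ⟨p, hp, hA, hv⟩
  exact ⟨p, hp, h hA, hv⟩

theorem relRange_append (G : LabelledGraph V E L) (A : Set V) (w w' : List L) :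
    G.relRange A (w ++ w') = G.relRange (G.relRange A w) w' := by
  induction w generalizing A with
  | nil => simp [relRange_nil]
  | cons a w ih =>
    ext v
    rw [List.cons_append, mem_relRange_cons, G.mem_relRange_iff_singleton]
    constructor
    · rintro ⟨e, h1, h2, h3⟩
      rw [ih, G.mem_relRange_iff_singleton] at h3
      obtain ⟨u, hu, hv⟩ := h3
      exact ⟨u, G.mem_relRange_cons.2 ⟨e, h1, h2, hu⟩, hv⟩
    · rintro ⟨u, hu, hv⟩
      obtain ⟨e, h1, h2, h3⟩ := G.mem_relRange_cons.1 hu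
      exact ⟨e, h1, h2, by rw [ih, G.mem_relRange_iff_singleton]; exact ⟨u, h3, hv⟩⟩

theorem isLabelledPath_of_nonempty (G : LabelledGraph V E L) {A : Set V} {w : List L}
    (h : (G.relRange A w).Nonempty) : G.IsLabelledPath w := by
  obtain ⟨_, p, hp, _⟩ := h
  exact Or.inr ⟨p, hp⟩

theorem isLabelledPath_of_append (G : LabelledGraph V E L) {w w' : List L}
    (h : G.IsLabelledPath (w ++ w')) : G.IsLabelledPath w' := by
  rcases h with h | ⟨p, hp⟩
  · exact Or.inl (List.append_eq_nil_iff.1 h).2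
  · have : p.range ∈ G.relRange Set.univ (w ++ w') := ⟨p, hp, trivial, rfl⟩
    rw [relRange_append] at this
    exact G.isLabelledPath_of_nonempty ⟨_, this⟩

end LabelledGraph

/-- A labelled space: a labelled graph with an accommodating family of sets of vertices. -/
structure LabelledSpace (V E L : Type*) extends LabelledGraph V E L where
  family : Set (Set V)
  relRange_mem : ∀ A ∈ family, ∀ w, toLabelledGraph.IsLabelledPath w →
    toLabelledGraph.relRange A w ∈ family
  inter_mem : ∀ A ∈ family, ∀ B ∈ family, A ∩ B ∈ family
  union_mem : ∀ A ∈ family, ∀ B ∈ family, A ∪ B ∈ family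
  wordRange_mem : ∀ w, w ≠ [] → toLabelledGraph.IsLabelledPath w →
    toLabelledGraph.wordRange w ∈ family

namespace LabelledSpace

variable {V E L : Type*}

/-- Weakly left resolving labelled spaces. -/
class WeaklyLeftResolving (X : LabelledSpace V E L) : Prop where
  relRange_inter : ∀ A ∈ X.family, ∀ B ∈ X.family, ∀ w, w ≠ [] → X.IsLabelledPath w →
    X.relRange (A ∩ B) w = X.relRange A w ∩ X.relRange B w

/-! ### The inverse semigroup of a labelled space -/

/-- The triples `(left, set, right)` with nonempty middle entry. -/
@[ext]
structure Triple (X : LabelledSpace V E L) where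
  left : List L
  set : Set V
  right : List L
  left_path : X.IsLabelledPath left
  right_path : X.IsLabelledPath right
  set_mem : set ∈ X.family
  set_left : set ⊆ X.wordRange left
  set_right : set ⊆ X.wordRange right
  set_nonempty : set.Nonempty

/-- The underlying set of the inverse semigroup `S`: the triples with nonempty middle entry and a
zero element, to which all triples with empty middle entry are collapsed. -/
inductive Semi (X : LabelledSpace V E L) where
  | zero : Semi X
  | triple (t : X.Triple) : Semi X

open Classical in
/-- The product `(α, A, β)(βγ', B, δ) = (αγ', r(A, γ') ∩ B, δ)`, where `c` stands for `γ'`. -/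
noncomputable def mulExtendLeft {X : LabelledSpace V E L} (s t : X.Triple) (c : List L)
    (hc : t.left = s.right ++ c) : X.Semi :=
  if h : (X.relRange s.set c ∩ t.set).Nonempty then
    have hs : X.relRange s.set c ⊆ X.wordRange (s.left ++ c) := by
      rw [LabelledGraph.wordRange, LabelledGraph.relRange_append]
      exact X.relRange_mono s.set_left c
    .triple
      { left := s.left ++ c
        set := X.relRange s.set c ∩ t.set
        right := t.right
        left_path := X.isLabelledPath_of_nonempty (h.mono (Set.inter_subset_left.trans hs))
        right_path := t.right_path
        set_mem := X.inter_mem _ (X.relRange_mem _ s.set_mem _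
          (X.isLabelledPath_of_append (hc ▸ t.left_path))) _ t.set_mem
        set_left := Set.inter_subset_left.trans hs
        set_right := Set.inter_subset_right.trans t.set_right
        set_nonempty := h }
  else .zero

open Classical in
/-- The product `(α, A, γβ')(γ, B, δ) = (α, A ∩ r(B, β'), δβ')`, where `b` stands for `β'`. -/
noncomputable def mulExtendRight {X : LabelledSpace V E L} (s t : X.Triple) (b : List L)
    (hb : s.right = t.left ++ b) : X.Semi :=
  if h : (s.set ∩ X.relRange t.set b).Nonempty then
    have ht : X.relRange t.set b ⊆ X.wordRange (t.right ++ b) := by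
      rw [LabelledGraph.wordRange, LabelledGraph.relRange_append]
      exact X.relRange_mono t.set_right b
    .triple
      { left := s.left
        set := s.set ∩ X.relRange t.set b
        right := t.right ++ b
        left_path := s.left_path
        right_path := X.isLabelledPath_of_nonempty (h.mono (Set.inter_subset_right.trans ht))
        set_mem := X.inter_mem _ s.set_mem _ (X.relRange_mem _ t.set_mem _
          (X.isLabelledPath_of_append (hb ▸ s.right_path)))
        set_left := Set.inter_subset_left.trans s.set_left
        set_right := Set.inter_subset_right.trans ht
        set_nonempty := h }
  else .zero

open Classical in
/-- The product of `S`. -/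
noncomputable def Semi.mul {X : LabelledSpace V E L} : X.Semi → X.Semi → X.Semi
  | .triple s, .triple t =>
    if h : s.right <+: t.left then
      mulExtendLeft s t (t.left.drop s.right.length) (List.prefix_iff_eq_append.1 h).symm
    else if h' : t.left <+: s.right then
      mulExtendRight s t (s.right.drop t.left.length) (List.prefix_iff_eq_append.1 h').symm
    else .zero
  | _, _ => .zero

noncomputable instance (X : LabelledSpace V E L) : Mul X.Semi := ⟨Semi.mul⟩

instance (X : LabelledSpace V E L) : Zero X.Semi := ⟨.zero⟩

/-- The set `E(S)` of idempotents of `S`. -/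
def Idem (X : LabelledSpace V E L) : Type _ := {p : X.Semi // IsIdempotentElem p}

/-! ### The semilattice `E(S)` -/

section Semilattice

variable {X : LabelledSpace V E L}

theorem Semi.zero_mul (s : X.Semi) : (0 : X.Semi) * s = 0 := by
  cases s <;> rfl

theorem Semi.mul_zero (s : X.Semi) : s * (0 : X.Semi) = 0 := by
  cases s <;> rfl

theorem Semi.triple_ne_zero (t : X.Triple) : Semi.triple t ≠ 0 := by
  rintro ⟨⟩

/-- The product is described on words and sets, up to the collapsing of empty sets. -/
theorem Semi.mul_of_left {s t : X.Triple} {c : List L} (hc : t.left = s.right ++ c)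
    (u : X.Triple) : Semi.triple s * Semi.triple t = Semi.triple u ↔
      u.left = s.left ++ c ∧ u.set = X.relRange s.set c ∩ t.set ∧ u.right = t.right := by
  have hp : s.right <+: t.left := ⟨c, hc.symm⟩
  have hd : t.left.drop s.right.length = c := by rw [hc]; simp
  change Semi.mul _ _ = _ ↔ _
  simp only [Semi.mul, dif_pos hp, mulExtendLeft, hd]
  split_ifs with h
  · rw [Semi.triple.injEq, Triple.ext_iff]
    simp only
    grind
  · refine ⟨fun h' => (nomatch h'), fun h' => (h ?_).elim⟩
    rw [hd, ← h'.2.1]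
    exact u.set_nonempty

theorem Semi.mul_of_right {s t : X.Triple} {b : List L} (hb : s.right = t.left ++ b)
    (u : X.Triple) : Semi.triple s * Semi.triple t = Semi.triple u ↔
      u.left = s.left ∧ u.set = s.set ∩ X.relRange t.set b ∧ u.right = t.right ++ b := by
  by_cases hp : s.right <+: t.left
  · obtain ⟨c, hc⟩ := hp
    have hbc : b = [] ∧ c = [] := by
      rw [hb] at hc
      simpa using hc
    obtain ⟨rfl, rfl⟩ := hbc
    rw [Semi.mul_of_left hc.symm]
    simp [LabelledGraph.relRange_nil]
  · have hp' : t.left <+: s.right := ⟨b, hb.symm⟩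
    have hd : s.right.drop t.left.length = b := by rw [hb]; simp
    change Semi.mul _ _ = _ ↔ _
    simp only [Semi.mul, dif_neg hp, dif_pos hp', mulExtendRight, hd]
    split_ifs with h
    · rw [Semi.triple.injEq, Triple.ext_iff]
      simp only
      grind
    · refine ⟨fun h' => (nomatch h'), fun h' => (h ?_).elim⟩
      rw [hd, ← h'.2.1]
      exact u.set_nonempty

theorem Semi.comparable_of_mul {s t u : X.Triple}
    (h : Semi.triple s * Semi.triple t = Semi.triple u) :
    s.right <+: t.left ∨ t.left <+: s.right := by
  by_contra! hn
  change Semi.mul _ _ = _ at h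
  simp [Semi.mul, dif_neg hn.1, dif_neg hn.2] at h

theorem Triple.isIdempotentElem_iff {t : X.Triple} :
    IsIdempotentElem (Semi.triple t) ↔ t.left = t.right := by
  constructor
  · intro h
    rcases Semi.comparable_of_mul h with ⟨c, hc⟩ | ⟨c, hc⟩
    · have := ((Semi.mul_of_left hc.symm t).1 h).1
      have hc' : c = [] := by simpa using this
      simpa [hc'] using hc.symm
    · have := ((Semi.mul_of_right hc.symm t).1 h).2.2
      have hc' : c = [] := by simpa using this
      simpa [hc'] using hc
  · intro h
    refine (Semi.mul_of_left (c := []) (by simp [h]) t).2 ?_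
    simp [LabelledGraph.relRange_nil]

theorem Semi.isIdempotentElem_zero : IsIdempotentElem (0 : X.Semi) := Semi.zero_mul 0

/-- Idempotents commute. -/
theorem Semi.mul_comm_of_idem {p q : X.Semi} (hp : IsIdempotentElem p)
    (hq : IsIdempotentElem q) : p * q = q * p := by
  cases p with
  | zero => exact (Semi.zero_mul q).trans (Semi.mul_zero q).symm
  | triple s =>
    cases q with
    | zero => exact (Semi.mul_zero _).trans (Semi.zero_mul _).symm
    | triple t =>
      rw [Triple.isIdempotentElem_iff] at hp hq
      have key : ∀ u, Semi.triple s * Semi.triple t = Semi.triple u ↔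
          Semi.triple t * Semi.triple s = Semi.triple u := by
        intro u
        constructor
        · intro h
          rcases Semi.comparable_of_mul h with ⟨c, hc⟩ | ⟨c, hc⟩
          · have h' := (Semi.mul_of_left hc.symm u).1 h
            refine (Semi.mul_of_right (b := c) (by rw [hp, hc, hq]) u).2 ?_
            refine ⟨?_, ?_, ?_⟩
            · rw [h'.1, hp, hc]
            · rw [h'.2.1, Set.inter_comm]
            · rw [h'.2.2, ← hq, hc]
          · have h' := (Semi.mul_of_right hc.symm u).1 h
            refine (Semi.mul_of_left (c := c) (by rw [hp, ← hc, hq]) u).2 ?_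
            refine ⟨?_, ?_, ?_⟩
            · rw [h'.1, hp, hc]
            · rw [h'.2.1, Set.inter_comm]
            · rw [h'.2.2, ← hq, hc]
        · intro h
          rcases Semi.comparable_of_mul h with ⟨c, hc⟩ | ⟨c, hc⟩
          · have h' := (Semi.mul_of_left hc.symm u).1 h
            refine (Semi.mul_of_right (b := c) (by rw [hq, hc, hp]) u).2 ?_
            refine ⟨?_, ?_, ?_⟩
            · rw [h'.1, hq, hc]
            · rw [h'.2.1, Set.inter_comm]
            · rw [h'.2.2, ← hp, hc]
          · have h' := (Semi.mul_of_right hc.symm u).1 h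
            refine (Semi.mul_of_left (c := c) (by rw [hq, ← hc, hp]) u).2 ?_
            refine ⟨?_, ?_, ?_⟩
            · rw [h'.1, hq, hc]
            · rw [h'.2.1, Set.inter_comm]
            · rw [h'.2.2, ← hp, hc]
      cases h1 : Semi.triple s * Semi.triple t with
      | triple u => exact ((key u).1 h1).symm
      | zero =>
        cases h2 : Semi.triple t * Semi.triple s with
        | zero => rfl
        | triple u => rw [(key u).2 h2] at h1; exact h1.symm

/-- Products of idempotents are idempotent. -/
theorem Semi.isIdempotentElem_mul {p q : X.Semi} (hp : IsIdempotentElem p)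
    (hq : IsIdempotentElem q) : IsIdempotentElem (p * q) := by
  cases p with
  | zero => exact (Semi.zero_mul q).symm ▸ Semi.isIdempotentElem_zero
  | triple s =>
    cases q with
    | zero => exact (Semi.mul_zero (Semi.triple s)).symm ▸ Semi.isIdempotentElem_zero
    | triple t =>
      rw [Triple.isIdempotentElem_iff] at hp hq
      cases h : Semi.triple s * Semi.triple t with
      | zero => exact Semi.isIdempotentElem_zero
      | triple u =>
        rw [Triple.isIdempotentElem_iff]
        rcases Semi.comparable_of_mul h with ⟨c, hc⟩ | ⟨c, hc⟩
        · obtain ⟨h1, _, h3⟩ := (Semi.mul_of_left hc.symm u).1 h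
          rw [h1, h3, hp, hc, hq]
        · obtain ⟨h1, _, h3⟩ := (Semi.mul_of_right hc.symm u).1 h
          rw [h1, h3, hp, ← hc, hq]

/-- The order of `E(S)` on nonzero elements. -/
theorem Triple.mul_eq_left_iff {s t : X.Triple} (hs : s.left = s.right)
    (ht : t.left = t.right) : Semi.triple s * Semi.triple t = Semi.triple s ↔
      ∃ b, s.left = t.left ++ b ∧ s.set ⊆ X.relRange t.set b := by
  constructor
  · intro h
    rcases Semi.comparable_of_mul h with ⟨c, hc⟩ | ⟨c, hc⟩
    · obtain ⟨h1, h2, h3⟩ := (Semi.mul_of_left hc.symm s).1 h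
      have hc' : c = [] := by simpa using h1
      subst hc'
      refine ⟨[], by simp [← hc, hs], ?_⟩
      rw [LabelledGraph.relRange_nil] at h2 ⊢
      exact Set.left_eq_inter.1 h2
    · obtain ⟨h1, h2, h3⟩ := (Semi.mul_of_right hc.symm s).1 h
      exact ⟨c, by rw [hs, hc], Set.left_eq_inter.1 h2⟩
  · rintro ⟨b, hb, hA⟩
    refine (Semi.mul_of_right (b := b) (by rw [← hs, hb]) s).2 ⟨rfl, ?_, ?_⟩
    · exact Set.left_eq_inter.2 hA
    · rw [← hs, hb, ht]

theorem Semi.idem_le_trans {p q r : X.Semi} (hp : IsIdempotentElem p) (hq : IsIdempotentElem q)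
    (hr : IsIdempotentElem r) (h1 : p * q = p) (h2 : q * r = q) : p * r = p := by
  cases p with
  | zero => exact Semi.zero_mul r
  | triple s =>
    cases q with
    | zero => exact absurd (h1.symm.trans (Semi.mul_zero _)) (Semi.triple_ne_zero s)
    | triple t =>
      cases r with
      | zero => exact absurd (h2.symm.trans (Semi.mul_zero _)) (Semi.triple_ne_zero t)
      | triple u =>
        rw [Triple.isIdempotentElem_iff] at hp hq hr
        rw [Triple.mul_eq_left_iff hp hq] at h1
        rw [Triple.mul_eq_left_iff hq hr] at h2
        rw [Triple.mul_eq_left_iff hp hr]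
        obtain ⟨b, hb, hA⟩ := h1
        obtain ⟨c, hc, hB⟩ := h2
        refine ⟨c ++ b, by rw [hb, hc, List.append_assoc], hA.trans ?_⟩
        rw [LabelledGraph.relRange_append]
        exact X.relRange_mono hB b

theorem Semi.idem_mul_le {p q : X.Semi} (hp : IsIdempotentElem p) (hq : IsIdempotentElem q) :
    (p * q) * p = p * q := by
  cases p with
  | zero => exact (Semi.mul_zero _).trans (Semi.zero_mul q).symm
  | triple s =>
    cases q with
    | zero =>
      have : Semi.triple s * Semi.zero = 0 := Semi.mul_zero _
      rw [this, Semi.zero_mul]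
    | triple t =>
      have hi := Semi.isIdempotentElem_mul hp hq
      cases h : Semi.triple s * Semi.triple t with
      | zero => exact Semi.zero_mul _
      | triple u =>
        rw [h] at hi
        rw [Triple.isIdempotentElem_iff] at hp hq hi
        rw [Triple.mul_eq_left_iff hi hp]
        rcases Semi.comparable_of_mul h with ⟨c, hc⟩ | ⟨c, hc⟩
        · obtain ⟨h1, h2, h3⟩ := (Semi.mul_of_left hc.symm u).1 h
          exact ⟨c, h1, by rw [h2]; exact Set.inter_subset_left⟩
        · obtain ⟨h1, h2, h3⟩ := (Semi.mul_of_right hc.symm u).1 h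
          refine ⟨[], by simp [h1], ?_⟩
          rw [h2, LabelledGraph.relRange_nil]
          exact Set.inter_subset_left

theorem relRange_inter [X.WeaklyLeftResolving] {A B : Set V} (hA : A ∈ X.family)
    (hB : B ∈ X.family) {w : List L} (hw : X.IsLabelledPath w) :
    X.relRange (A ∩ B) w = X.relRange A w ∩ X.relRange B w := by
  by_cases h : w = []
  · simp [h, LabelledGraph.relRange_nil]
  · exact WeaklyLeftResolving.relRange_inter A hA B hB w h hw

theorem Semi.idem_le_mul [X.WeaklyLeftResolving] {p q r : X.Semi} (hp : IsIdempotentElem p)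
    (hq : IsIdempotentElem q) (hr : IsIdempotentElem r) (h1 : p * q = p) (h2 : p * r = p) :
    p * (q * r) = p := by
  cases p with
  | zero => exact Semi.zero_mul _
  | triple s =>
    cases q with
    | zero => exact absurd (h1.symm.trans (Semi.mul_zero _)) (Semi.triple_ne_zero s)
    | triple t =>
      cases r with
      | zero => exact absurd (h2.symm.trans (Semi.mul_zero _)) (Semi.triple_ne_zero s)
      | triple u =>
        -- The case in which the word of the first factor is a beginning of the word of the second.
        have key : ∀ t u : X.Triple, t.left = t.right → u.left = u.right →
            Semi.triple s * Semi.triple t = Semi.triple s →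
            Semi.triple s * Semi.triple u = Semi.triple s → t.left <+: u.left →
            Semi.triple s * (Semi.triple t * Semi.triple u) = Semi.triple s := by
          rintro t u ht hu h1 h2 ⟨c, hc⟩
          have hs := Triple.isIdempotentElem_iff.1 hp
          have hi := Semi.isIdempotentElem_mul (Triple.isIdempotentElem_iff.2 ht)
            (Triple.isIdempotentElem_iff.2 hu)
          obtain ⟨b, hb, hA⟩ := (Triple.mul_eq_left_iff hs ht).1 h1
          obtain ⟨d, hd, hB⟩ := (Triple.mul_eq_left_iff hs hu).1 h2
          have hbd : b = c ++ d := by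
            rw [hb, ← hc, List.append_assoc] at hd
            exact List.append_cancel_left hd
          have hcp : X.IsLabelledPath c :=
            X.isLabelledPath_of_append (w := t.left) (hc ▸ u.left_path)
          have hdp : X.IsLabelledPath d :=
            X.isLabelledPath_of_append (w := u.left) (hd ▸ s.left_path)
          have hsub : s.set ⊆ X.relRange (X.relRange t.set c ∩ u.set) d := by
            rw [relRange_inter (X.relRange_mem _ t.set_mem _ hcp) u.set_mem hdp,
              ← LabelledGraph.relRange_append, ← hbd]
            exact Set.subset_inter hA hB
          cases h : Semi.triple t * Semi.triple u with
          | zero =>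
            exfalso
            have hne : (X.relRange t.set c ∩ u.set).Nonempty := by
              obtain ⟨v, hv⟩ := s.set_nonempty
              obtain ⟨p, _, hp, _⟩ := hsub hv
              exact ⟨_, hp⟩
            have hp : t.right <+: u.left := ⟨c, by rw [← ht, hc]⟩
            have hdr : u.left.drop t.right.length = c := by rw [← hc, ht]; simp
            change Semi.mul _ _ = _ at h
            simp [Semi.mul, dif_pos hp, mulExtendLeft, hdr, hne] at h
          | triple x =>
            rw [h, Triple.isIdempotentElem_iff] at hi
            obtain ⟨k1, k2, k3⟩ := (Semi.mul_of_left (c := c) (by rw [← ht, hc]) x).1 h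
            exact (Triple.mul_eq_left_iff hs hi).2
              ⟨d, by rw [hd, k1, hc], by rw [k2]; exact hsub⟩
        have hs := Triple.isIdempotentElem_iff.1 hp
        have ht := Triple.isIdempotentElem_iff.1 hq
        have hu := Triple.isIdempotentElem_iff.1 hr
        obtain ⟨b, hb, -⟩ := (Triple.mul_eq_left_iff hs ht).1 h1
        obtain ⟨d, hd, -⟩ := (Triple.mul_eq_left_iff hs hu).1 h2
        rcases List.prefix_or_prefix_of_prefix ⟨b, hb.symm⟩ ⟨d, hd.symm⟩ with h | h
        · exact key t u ht hu h1 h2 h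
        · rw [Semi.mul_comm_of_idem hq hr]
          exact key u t hu ht h2 h1 h

/-- `E(S)` is a semilattice: `p ≤ q` means `p q = p`, and the meet is the product. -/
noncomputable instance [X.WeaklyLeftResolving] : SemilatticeInf X.Idem where
  le p q := p.1 * q.1 = p.1
  inf p q := ⟨p.1 * q.1, Semi.isIdempotentElem_mul p.2 q.2⟩
  le_refl p := p.2
  le_trans p q r h1 h2 := Semi.idem_le_trans p.2 q.2 r.2 h1 h2
  le_antisymm p q h1 h2 :=
    Subtype.ext (h1.symm.trans ((Semi.mul_comm_of_idem p.2 q.2).trans h2))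
  inf_le_left p q := Semi.idem_mul_le p.2 q.2
  inf_le_right p q := by
    change (p.1 * q.1) * q.1 = p.1 * q.1
    rw [Semi.mul_comm_of_idem p.2 q.2]
    exact Semi.idem_mul_le q.2 p.2
  le_inf p q r h1 h2 := Semi.idem_le_mul p.2 q.2 r.2 h1 h2

/-- The least element of `E(S)` is `0`. -/
noncomputable instance [X.WeaklyLeftResolving] : OrderBot X.Idem where
  bot := ⟨0, Semi.isIdempotentElem_zero⟩
  bot_le p := Semi.zero_mul p.1

end Semilattice

end LabelledSpace

/-! ### Characters and the tight spectrum of a semilattice with zero -/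

section Characters

variable {P : Type*} [SemilatticeInf P] [OrderBot P]

/-- Characters of a semilattice with zero: nonzero maps to the Boolean algebra `{0, 1}` that
preserve zero and meets. -/
structure IsSemilatticeCharacter (f : P → Bool) : Prop where
  nonzero : ∃ x, f x ≠ ⊥
  map_bot : f ⊥ = ⊥
  map_inf : ∀ x y, f (x ⊓ y) = f x ⊓ f y

/-- `Z` is a cover for `x`. -/
def IsSemilatticeCover (Z : Set P) (x : P) : Prop :=
  Z ⊆ Set.Iic x ∧ ∀ y ≤ x, y ≠ ⊥ → ∃ z ∈ Z, z ⊓ y ≠ ⊥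

variable (P) in
/-- The tight spectrum: the set of tight characters. Its topology is the one of pointwise
convergence, induced from the product topology of the functions to the discrete space `Bool`. -/
def tightSpectrum : Set (P → Bool) :=
  {f | IsSemilatticeCharacter f ∧
    ∀ (x : P) (Z : Finset P), IsSemilatticeCover (Z : Set P) x → Z.sup f = f x}

end Characters

/-! ### The labelled space with accommodating family the power set -/

namespace LabelledGraph

variable {V E L : Type*}

/-- The labelled space given by a labelled graph and the family of all sets of vertices. -/
def powersetSpace (G : LabelledGraph V E L) : LabelledSpace V E L where
  toLabelledGraph := G
  family := Set.univ
  relRange_mem := fun _ _ _ _ => trivial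
  inter_mem := fun _ _ _ _ => trivial
  union_mem := fun _ _ _ _ => trivial
  wordRange_mem := fun _ _ _ => trivial

theorem eq_of_mem_relRange (G : LabelledGraph V E L) [G.LeftResolving] {w : List L} {u u' v : V}
    (h : v ∈ G.relRange {u} w) (h' : v ∈ G.relRange {u'} w) : u = u' := by
  induction w generalizing u u' with
  | nil =>
    have h1 : v = u := by simpa [G.mem_relRange_nil] using h
    have h2 : v = u' := by simpa [G.mem_relRange_nil] using h'
    exact h1.symm.trans h2
  | cons a w ih =>
    obtain ⟨e, h1, h2, h3⟩ := G.mem_relRange_cons.1 h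
    obtain ⟨f, k1, k2, k3⟩ := G.mem_relRange_cons.1 h'
    have hef := LeftResolving.eq_of_range_eq e f (ih h3 k3) (h2.trans k2.symm)
    subst hef
    exact (Set.mem_singleton_iff.1 h1).symm.trans (Set.mem_singleton_iff.1 k1)

instance (G : LabelledGraph V E L) [G.LeftResolving] :
    G.powersetSpace.WeaklyLeftResolving where
  relRange_inter A _ B _ w _ _ := by
    change G.relRange (A ∩ B) w = G.relRange A w ∩ G.relRange B w
    refine Set.Subset.antisymm (Set.subset_inter (G.relRange_mono Set.inter_subset_left w)
      (G.relRange_mono Set.inter_subset_right w)) ?_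
    rintro v ⟨hA, hB⟩
    obtain ⟨u, hu, hv⟩ := G.mem_relRange_iff_singleton.1 hA
    obtain ⟨u', hu', hv'⟩ := G.mem_relRange_iff_singleton.1 hB
    have := G.eq_of_mem_relRange hv hv'
    subst this
    exact G.mem_relRange_iff_singleton.2 ⟨u, ⟨hu, hu'⟩, hv⟩

end LabelledGraph

/-! Since the labelling is left resolving, a finite path `p` is determined by its label and its
range, so the idempotent `pathIdem p` = (label of `p`, {range of `p`}, label of `p`) encodes it. On
these idempotents the order is reversed extension of paths, and every nonzero idempotent lies above
one of them. An idempotent (α, A, α) has one representative for each vertex of A, hence finitely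
many, and these cover it. A tight character is therefore determined by its values at path
idempotents (`tight_eq_true_iff`).

The paths at which a tight character is 1 form a nonempty chain closed under beginnings. If one of
them ends in a regular vertex, its finitely many one-edge extensions cover it, so one of these
belongs to the chain as well. Such a chain is the set of beginnings of a unique boundary path
(`exists_boundaryPath`, `AnyPath.ext_of_isBeginning`).

Conversely, `pathCharacter x` is 1 at z when a representative of z is a beginning of x. It is tight
because a beginning of a boundary path can be extended so that it is incompatible with any given
finite set of paths that are not beginnings of x (`exists_extension_avoiding`). Its value at z is a
finite supremum of coordinates of `beginnings x`, so the two topologies agree. -/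

namespace DirectedGraph

variable {V E : Type*} {G : DirectedGraph V E}

/-! ### Finite paths and their beginnings -/

theorem isPathFrom_append {v : V} {l m : List E} :
    G.IsPathFrom v (l ++ m) ↔ G.IsPathFrom v l ∧ G.IsPathFrom (G.endpoint v l) m := by
  induction l generalizing v with
  | nil => simp [IsPathFrom, endpoint]
  | cons e l ih =>
    simp only [List.cons_append, IsPathFrom, ih, and_assoc]
    rfl

theorem FinPath.source_eq_getElem (p : G.FinPath) (h : 0 < p.edges.length) :
    p.source = G.source p.edges[0] := by
  obtain ⟨v, l, hl⟩ := p
  cases l with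
  | nil => simp at h
  | cons e l => exact hl.1.symm

theorem FinPath.range_eq_getElem (p : G.FinPath) {n : ℕ} (h : p.edges.length = n + 1) :
    p.range = G.range (p.edges[n]'(by omega)) := by
  obtain ⟨v, l, hl⟩ := p
  obtain ⟨l', e, rfl⟩ := List.eq_nil_or_concat l |>.resolve_left (by rintro rfl; simp at h)
  have hn : l'.length = n := by simpa using h
  subst hn
  simp [FinPath.range, endpoint]

/-- The beginning of length at most `n` of a finite path. -/
def FinPath.take (p : G.FinPath) (n : ℕ) : G.FinPath where
  source := p.source
  edges := p.edges.take n
  isPath := by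
    have h := p.isPath
    rw [← List.take_append_drop n p.edges, isPathFrom_append] at h
    exact h.1

/-- The extension of a finite path by an edge. -/
def FinPath.snoc (p : G.FinPath) (e : E) (he : G.source e = p.range) : G.FinPath where
  source := p.source
  edges := p.edges ++ [e]
  isPath := isPathFrom_append.2 ⟨p.isPath, he, trivial⟩

theorem FinPath.take_isBeginning (p : G.FinPath) (n : ℕ) : IsBeginning (p.take n) (.fin p) :=
  ⟨rfl, List.take_prefix n p.edges⟩

theorem IsBeginning.refl (p : G.FinPath) : IsBeginning p (.fin p) := ⟨rfl, List.prefix_rfl⟩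

theorem IsBeginning.trans {m p : G.FinPath} {x : G.AnyPath} (h : IsBeginning m (.fin p))
    (h' : IsBeginning p x) : IsBeginning m x := by
  cases x with
  | fin q => exact ⟨h.1.trans h'.1, h.2.trans h'.2⟩
  | inf q =>
    refine ⟨h.1.trans h'.1, fun i hi => ?_⟩
    rw [h.2.getElem hi]
    exact h'.2 i _

/-- Two beginnings of a path are comparable. -/
theorem IsBeginning.of_length_le {m p : G.FinPath} {x : G.AnyPath} (hm : IsBeginning m x)
    (hp : IsBeginning p x) (h : m.edges.length ≤ p.edges.length) : IsBeginning m (.fin p) := by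
  cases x with
  | fin q =>
    exact ⟨hm.1.trans hp.1.symm, List.prefix_of_prefix_length_le hm.2 hp.2 h⟩
  | inf q =>
    refine ⟨hm.1.trans hp.1.symm, List.prefix_iff_eq_take.2 ?_⟩
    apply List.ext_getElem
    · simp [h]
    · intro i h1 h2
      rw [List.getElem_take, hm.2 i h1, hp.2 i (h1.trans_le h)]

theorem IsBeginning.total {m p : G.FinPath} {x : G.AnyPath} (hm : IsBeginning m x)
    (hp : IsBeginning p x) : IsBeginning m (.fin p) ∨ IsBeginning p (.fin m) :=
  (le_total m.edges.length p.edges.length).imp (hm.of_length_le hp) (hp.of_length_le hm)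

theorem IsBeginning.antisymm {m p : G.FinPath} (h : IsBeginning m (.fin p))
    (h' : IsBeginning p (.fin m)) : m = p :=
  FinPath.ext h.1 (h.2.eq_of_length_le h'.2.length_le)

theorem FinPath.isBeginning_snoc (p : G.FinPath) (e : E) (he : G.source e = p.range) :
    IsBeginning p (.fin (p.snoc e he)) :=
  ⟨rfl, List.prefix_append _ _⟩

/-- A proper beginning of an extension by one edge is a beginning of the path. -/
theorem IsBeginning.of_snoc {m p : G.FinPath} {e : E} {he : G.source e = p.range}
    (h : IsBeginning m (.fin (p.snoc e he))) : m = p.snoc e he ∨ IsBeginning m (.fin p) := by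
  rcases h with ⟨h1, h2⟩
  rcases List.prefix_concat_iff.1 h2 with h2 | h2
  · exact Or.inl (FinPath.ext h1 h2)
  · exact Or.inr ⟨h1, h2⟩

/-- A proper extension of a path begins with an extension by one edge. -/
theorem IsBeginning.eq_or_snoc {p q : G.FinPath} (h : IsBeginning p (.fin q)) :
    p = q ∨ ∃ (e : E) (he : G.source e = p.range), IsBeginning (p.snoc e he) (.fin q) := by
  obtain ⟨h1, l, h2⟩ := h
  cases l with
  | nil => exact Or.inl (FinPath.ext h1 (by simpa using h2))
  | cons e l =>
    have hq := q.isPath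
    rw [← h2, isPathFrom_append, ← h1] at hq
    exact Or.inr ⟨e, hq.2.1, h1, l, by simp [FinPath.snoc, ← h2]⟩

/-! ### Infinite paths, and boundary paths recovered from their beginnings -/

/-- The first `n` edges of an infinite path form a path that ends at the source of the next edge. -/
theorem InfPath.isPathFrom_ofFn (x : G.InfPath) (n : ℕ) :
    G.IsPathFrom (G.source (x.edge 0)) (List.ofFn fun i : Fin n => x.edge i) ∧
      G.endpoint (G.source (x.edge 0)) (List.ofFn fun i : Fin n => x.edge i) =
        G.source (x.edge n) := by
  induction n with
  | zero => exact ⟨trivial, rfl⟩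
  | succ n ih =>
    rw [List.ofFn_succ_last]
    refine ⟨isPathFrom_append.2 ⟨ih.1, ih.2.symm, trivial⟩, ?_⟩
    simpa [endpoint] using x.isPath n

/-- The beginning of length `n` of an infinite path. -/
def InfPath.take (x : G.InfPath) (n : ℕ) : G.FinPath where
  source := G.source (x.edge 0)
  edges := List.ofFn fun i : Fin n => x.edge i
  isPath := (x.isPathFrom_ofFn n).1

theorem InfPath.take_isBeginning (x : G.InfPath) (n : ℕ) : IsBeginning (x.take n) (.inf x) :=
  ⟨rfl, fun i hi => by simp [InfPath.take]⟩

theorem InfPath.length_take (x : G.InfPath) (n : ℕ) : (x.take n).edges.length = n := by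
  simp [InfPath.take]

theorem exists_isBeginning (x : G.AnyPath) : ∃ m, IsBeginning m x := by
  cases x with
  | fin p => exact ⟨p, IsBeginning.refl p⟩
  | inf p => exact ⟨_, p.take_isBeginning 0⟩

/-- A path is determined by its beginnings. -/
theorem AnyPath.ext_of_isBeginning {x y : G.AnyPath}
    (h : ∀ m, IsBeginning m x ↔ IsBeginning m y) : x = y := by
  have not_inf : ∀ (p : G.FinPath) (q : G.InfPath),
      ¬ ∀ m, IsBeginning m (.inf q) → IsBeginning m (.fin p) := by
    intro p q h
    have h1 := (h _ (q.take_isBeginning (p.edges.length + 1))).2.length_le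
    rw [q.length_take] at h1
    omega
  cases x with
  | fin p =>
    cases y with
    | fin q =>
      exact congrArg _ (((h p).1 (IsBeginning.refl p)).antisymm ((h q).2 (IsBeginning.refl q)))
    | inf q => exact (not_inf p q fun m => (h m).2).elim
  | inf p =>
    cases y with
    | fin q => exact (not_inf q p fun m => (h m).1).elim
    | inf q =>
      congr 1
      ext i
      have h1 := ((h _).1 (p.take_isBeginning (i + 1))).2 i (by rw [p.length_take]; omega)
      rw [← h1]
      simp only [InfPath.take, List.getElem_ofFn]

/-- A set of paths that is closed under beginnings, is a nonempty chain and contains with each path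
that has a regular range an extension of it is the set of beginnings of a boundary path. -/
theorem exists_boundaryPath {C : Set G.FinPath} (hne : C.Nonempty)
    (hdown : ∀ p ∈ C, ∀ m, IsBeginning m (.fin p) → m ∈ C)
    (hchain : ∀ p ∈ C, ∀ q ∈ C, IsBeginning p (.fin q) ∨ IsBeginning q (.fin p))
    (hext : ∀ p ∈ C, ¬ G.IsSingular p.range → ∃ e he, p.snoc e he ∈ C) :
    ∃ x ∈ G.boundaryPathSpace, ∀ m, IsBeginning m x ↔ m ∈ C := by
  have hle : ∀ p ∈ C, ∀ q ∈ C, p.edges.length ≤ q.edges.length → IsBeginning p (.fin q) := by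
    intro p hp q hq h
    rcases hchain p hp q hq with h' | h'
    · exact h'
    · exact (IsBeginning.refl p).of_length_le h' h
  -- A longest member of `C` is itself the boundary path: its range is singular, as otherwise `hext`
  -- would give a longer member. Without a longest member there are members of every length, which
  -- glue to an infinite path.
  by_cases hb : ∃ p ∈ C, ∀ q ∈ C, q.edges.length ≤ p.edges.length
  · obtain ⟨p, hp, hmax⟩ := hb
    refine ⟨.fin p, ?_, fun m => ⟨hdown p hp m, fun hm => hle m hm p hp (hmax m hm)⟩⟩
    by_contra hs
    obtain ⟨e, he, h⟩ := hext p hp hs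
    have := hmax _ h
    simp [FinPath.snoc] at this
  · push Not at hb
    have hlen : ∀ n, ∃ p ∈ C, p.edges.length = n := by
      have hge : ∀ n, ∃ p ∈ C, n ≤ p.edges.length := by
        intro n
        induction n with
        | zero => exact hne.imp fun p hp => ⟨hp, Nat.zero_le _⟩
        | succ n ih =>
          obtain ⟨p, hp, h⟩ := ih
          obtain ⟨q, hq, h'⟩ := hb p hp
          exact ⟨q, hq, by omega⟩
      intro n
      obtain ⟨p, hp, h⟩ := hge n
      exact ⟨p.take n, hdown p hp _ (p.take_isBeginning n), by simpa [FinPath.take] using h⟩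
    choose c hc hcl using hlen
    -- The edge with index `i` is read off `c (i + 1)`, the shortest chosen member that has one;
    -- every longer member agrees there.
    have hcget : ∀ (p : G.FinPath) (_ : p ∈ C) (i : ℕ) (hi : i < p.edges.length),
        p.edges[i] = (c (i + 1)).edges[i]'(by rw [hcl]; omega) := by
      intro p hp i hi
      have h := hle _ (hc (i + 1)) p hp (by rw [hcl]; omega)
      exact (h.2.getElem _).symm
    have hstep : ∀ i, G.range ((c (i + 1)).edges[i]'(by rw [hcl]; omega)) =
        G.source ((c (i + 2)).edges[i + 1]'(by rw [hcl]; omega)) := by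
      intro i
      rcases (hle _ (hc (i + 1)) _ (hc (i + 2)) (by simp [hcl])).eq_or_snoc with h | ⟨e, he, h⟩
      · have := congrArg (fun p : G.FinPath => p.edges.length) h
        simp [hcl] at this
      · have h1 := h.2.getElem (i := i + 1) (by simp [FinPath.snoc, hcl])
        have h2 : e = (c (i + 2)).edges[i + 1]'(by rw [hcl]; omega) := by
          simpa [FinPath.snoc, hcl] using h1
        rw [← h2, he, (c (i + 1)).range_eq_getElem (hcl _)]
    have hsrc : ∀ p ∈ C, p.source = G.source ((c 1).edges[0]'(by rw [hcl]; omega)) := by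
      intro p hp
      have h1 : p.source = (c 1).source := by
        rcases hchain p hp _ (hc 1) with h | h
        · exact h.1
        · exact h.1.symm
      rw [h1, (c 1).source_eq_getElem]
    let x : G.InfPath := ⟨fun i => (c (i + 1)).edges[i]'(by rw [hcl]; omega), hstep⟩
    have hx : ∀ p ∈ C, IsBeginning p (.inf x) := fun p hp => ⟨hsrc p hp, hcget p hp⟩
    refine ⟨.inf x, trivial, fun m => ⟨fun hm => ?_, hx m⟩⟩
    have h := hm.of_length_le (hx _ (hc m.edges.length)) (by rw [hcl])
    exact hdown _ (hc _) m h

/-- A beginning of a boundary path has an extension such that the members of a given finite set of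
paths that are comparable to it are beginnings of the boundary path. -/
theorem exists_extension_avoiding {x : G.AnyPath} (hx : x ∈ G.boundaryPathSpace)
    {p : G.FinPath} (hp : IsBeginning p x) {F : Set G.FinPath} (hF : F.Finite) :
    ∃ q, IsBeginning p (.fin q) ∧ ∀ m ∈ F, ∀ k : G.FinPath, IsBeginning m (.fin k) →
      IsBeginning q (.fin k) → IsBeginning m x := by
  cases x with
  | inf x =>
    -- A beginning of `x` at least as long as all members of `F` suffices: a member compatible with
    -- it is then one of its beginnings.
    obtain ⟨N, hN⟩ := (hF.image fun m => m.edges.length).bddAbove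
    have hN' : ∀ m ∈ F, m.edges.length ≤ N := fun m hm => hN ⟨m, hm, rfl⟩
    refine ⟨x.take (max N p.edges.length), hp.of_length_le (x.take_isBeginning _) ?_, ?_⟩
    · rw [x.length_take]; exact le_max_right _ _
    · intro m hm k h1 h2
      refine (h1.of_length_le h2 ?_).trans (x.take_isBeginning _)
      rw [x.length_take]; exact (hN' m hm).trans (le_max_left _ _)
  | fin x =>
    rcases hx with hx | hx
    -- At a sink `x` has no proper extension, so `k` is `x` itself.
    · refine ⟨x, hp, fun m _ k h1 h2 => ?_⟩
      rcases h2.eq_or_snoc with rfl | ⟨e, he, _⟩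
      · exact h1
      · exact (Set.eq_empty_iff_forall_notMem.1 hx e he).elim
    -- At an infinite emitter, `x` is extended by an edge outside `B`, the edges by which members of
    -- `F` continue beyond `x`. `B` is finite because each member has at most one edge at position
    -- `x.edges.length`.
    · let B : Set E := {e | ∃ he : G.source e = x.range, ∃ m ∈ F,
        IsBeginning (x.snoc e he) (.fin m)}
      have hB : B.Finite := by
        refine (hF.image fun m => m.edges[x.edges.length]?).preimage
          (Option.some_injective E).injOn |>.subset ?_
        rintro e ⟨he, m, hm, h⟩
        refine ⟨m, hm, ?_⟩
        obtain ⟨l, hl⟩ := h.2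
        simp [← hl, FinPath.snoc]
      obtain ⟨e, he, heB⟩ := hx.exists_notMem_finite hB
      refine ⟨x.snoc e he, hp.trans (x.isBeginning_snoc e he), fun m hm k h1 h2 => ?_⟩
      rcases h1.total h2 with h | h
      · rcases h.of_snoc with rfl | h
        · exact (heB ⟨he, _, hm, IsBeginning.refl _⟩).elim
        · exact h
      · exact (heB ⟨he, m, hm, h⟩).elim

end DirectedGraph

/-! ### Path idempotents and representatives -/

namespace LabelledGraph

open DirectedGraph

variable {V E L : Type*} (G : LabelledGraph V E L)

/-- The idempotent given by a finite path: its label together with its range. -/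
def pathIdem (p : G.FinPath) : G.powersetSpace.Idem :=
  ⟨.triple
    { left := p.edges.map G.label
      set := {p.range}
      right := p.edges.map G.label
      left_path := Or.inr ⟨p, rfl⟩
      right_path := Or.inr ⟨p, rfl⟩
      set_mem := trivial
      set_left := Set.singleton_subset_iff.2 ⟨p, rfl, trivial, rfl⟩
      set_right := Set.singleton_subset_iff.2 ⟨p, rfl, trivial, rfl⟩
      set_nonempty := Set.singleton_nonempty _ },
    LabelledSpace.Triple.isIdempotentElem_iff.2 rfl⟩

/-- The representatives of a nonzero idempotent `(α, A, α)`: the finite paths with label `α` and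
range in `A`. -/
def idemPaths (z : G.powersetSpace.Idem) : Set G.FinPath :=
  {p | ∃ t, z.1 = .triple t ∧ p.edges.map G.label = t.left ∧ p.range ∈ t.set}

variable {G}

/-- The part of `p` beyond `m` is a path starting at the range of `m`, and cancelling the label of
`m` shows that its label is `b`. This translates beginnings into the relative ranges that define the
order of E(S). -/
theorem isBeginning_range_mem_relRange {m p : G.FinPath} (h : IsBeginning m (.fin p)) {b : List L}
    (hb : p.edges.map G.label = m.edges.map G.label ++ b) : p.range ∈ G.relRange {m.range} b := by
  obtain ⟨h1, l, hl⟩ := h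
  have hp := p.isPath
  rw [← hl, isPathFrom_append, ← h1] at hp
  refine ⟨⟨m.range, l, hp.2⟩, ?_, rfl, ?_⟩
  · rw [← hl, List.map_append] at hb
    exact List.append_cancel_left hb
  · simp [FinPath.range, endpoint, ← hl, h1]

open Classical in
/-- The character of a path takes the value `1` at the idempotents that have a representative among
the beginnings of the path. -/
noncomputable def pathCharacter (x : G.AnyPath) : G.powersetSpace.Idem → Bool :=
  fun z => decide (∃ m ∈ G.idemPaths z, IsBeginning m x)

theorem pathCharacter_eq_true_iff {x : G.AnyPath} {z : G.powersetSpace.Idem} :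
    pathCharacter x z = true ↔ ∃ m ∈ G.idemPaths z, IsBeginning m x := by
  simp [pathCharacter]

variable [G.LeftResolving]

/-- In a left resolving labelled graph a finite path is determined by its label and its range. -/
theorem finPath_ext {p q : G.FinPath} (hl : p.edges.map G.label = q.edges.map G.label)
    (hr : p.range = q.range) : p = q := by
  obtain ⟨u, l, hp⟩ := p
  obtain ⟨v, m, hq⟩ := q
  simp only at hl
  induction l generalizing u v m with
  | nil =>
    obtain rfl : m = [] := by simpa using hl.symm
    obtain rfl : u = v := hr
    rfl
  | cons e l ih =>
    cases m with
    | nil => simp at hl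
    | cons f m =>
      simp only [List.map_cons, List.cons.injEq] at hl
      -- The tails agree first; their common source is the common range of `e` and `f`, which is
      -- what left resolving needs.
      have h := ih (G.range e) hp.2 (G.range f) m hq.2 hl.2 hr
      simp only [FinPath.mk.injEq] at h
      have hef := LeftResolving.eq_of_range_eq e f h.1 hl.1
      subst hef
      obtain rfl : u = v := hp.1.symm.trans hq.1
      simp [h.2]

theorem pathIdem_ne_bot (p : G.FinPath) : G.pathIdem p ≠ ⊥ :=
  fun h => LabelledSpace.Semi.triple_ne_zero _ (congrArg Subtype.val h)

/-- The only candidate for `m` is the beginning of `p` whose length is that of the word of `z`. This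
turns the order of E(S) into combinatorics of paths. -/
theorem pathIdem_le_iff {p : G.FinPath} {z : G.powersetSpace.Idem} :
    G.pathIdem p ≤ z ↔ ∃ m ∈ G.idemPaths z, IsBeginning m (.fin p) := by
  change (G.pathIdem p).1 * z.1 = (G.pathIdem p).1 ↔ _
  obtain ⟨s, hs⟩ := z
  cases s with
  | zero =>
    constructor
    · intro h
      exact (LabelledSpace.Semi.triple_ne_zero _
        (h.symm.trans (LabelledSpace.Semi.mul_zero _))).elim
    · rintro ⟨m, ⟨t, ht, _⟩, _⟩
      cases ht
  | triple t =>
    have ht := LabelledSpace.Triple.isIdempotentElem_iff.1 hs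
    refine (LabelledSpace.Triple.mul_eq_left_iff rfl ht).trans ?_
    constructor
    · rintro ⟨b, hb, hsub⟩
      have hb : p.edges.map G.label = t.left ++ b := hb
      have hm : (p.take t.left.length).edges.map G.label = t.left := by
        rw [FinPath.take, List.map_take, hb, List.take_left]
      refine ⟨p.take t.left.length, ⟨t, rfl, hm, ?_⟩, p.take_isBeginning _⟩
      -- The range of `p` is reached along `b` from the range of the beginning and also from some
      -- vertex of `t.set`; by left resolving these vertices coincide.
      have h1 := isBeginning_range_mem_relRange (p.take_isBeginning t.left.length) (hm.symm ▸ hb)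
      have h2 : p.range ∈ G.relRange t.set b := hsub rfl
      obtain ⟨u, hu, h3⟩ := G.mem_relRange_iff_singleton.1 h2
      rwa [G.eq_of_mem_relRange h1 h3]
    · rintro ⟨m, ⟨t', ht', hm, hr⟩, h⟩
      cases ht'
      obtain ⟨l, hl⟩ := h.2
      have hb : p.edges.map G.label = m.edges.map G.label ++ l.map G.label := by
        rw [← hl, List.map_append]
      refine ⟨l.map G.label, hm ▸ hb, Set.singleton_subset_iff.2 ?_⟩
      exact G.relRange_mono (Set.singleton_subset_iff.2 hr) _
        (isBeginning_range_mem_relRange h hb)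

theorem idemPaths_pathIdem (p : G.FinPath) : G.idemPaths (G.pathIdem p) = {p} := by
  ext q
  constructor
  · rintro ⟨t, ht, hl, hr⟩
    cases ht
    exact finPath_ext hl hr
  · rintro rfl
    exact ⟨_, rfl, rfl, rfl⟩

theorem pathIdem_le_pathIdem_iff {p q : G.FinPath} :
    G.pathIdem p ≤ G.pathIdem q ↔ IsBeginning q (.fin p) := by
  simp [pathIdem_le_iff, idemPaths_pathIdem]

theorem pathIdem_le_of_mem {p : G.FinPath} {z : G.powersetSpace.Idem} (h : p ∈ G.idemPaths z) :
    G.pathIdem p ≤ z :=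
  pathIdem_le_iff.2 ⟨p, h, IsBeginning.refl p⟩

/-- A vertex of the middle entry lies in the range of the word, so some path with that label ends
there. Hence covers and nonzero meets can be tested on path idempotents. -/
theorem exists_pathIdem_le {z : G.powersetSpace.Idem} (hz : z ≠ ⊥) : ∃ p, G.pathIdem p ≤ z := by
  obtain ⟨s, hs⟩ := z
  cases s with
  | zero => exact (hz rfl).elim
  | triple t =>
    obtain ⟨v, hv⟩ := t.set_nonempty
    obtain ⟨p, hp, -, rfl⟩ := t.set_left hv
    exact ⟨p, pathIdem_le_of_mem ⟨t, rfl, hp, hv⟩⟩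

/-- Representatives share one label, so they are distinguished by their ranges. This is where
finiteness of the vertex set enters. -/
theorem finite_idemPaths [Finite V] (z : G.powersetSpace.Idem) : (G.idemPaths z).Finite := by
  refine Set.Finite.of_injOn (f := FinPath.range) (t := Set.univ) (fun _ _ => trivial) ?_
    Set.finite_univ
  rintro p ⟨t, ht, hp, -⟩ q ⟨t', ht', hq, -⟩ h
  obtain rfl : t = t' := by simpa using ht.symm.trans ht'
  exact finPath_ext (hp.trans hq.symm) h

/-! ### From tight characters to boundary paths -/

section TightCharacters

variable {f : G.powersetSpace.Idem → Bool}

theorem character_mono (hf : IsSemilatticeCharacter f) {y z : G.powersetSpace.Idem} (h : y ≤ z)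
    (hy : f y = true) : f z = true := by
  have := hf.map_inf y z
  rw [inf_eq_left.2 h, hy] at this
  simpa using this.symm

/-- A tight character that takes the value `1` at `z` does so at a member of a finite family of
idempotents given by paths, if they cover `z`. -/
theorem exists_of_tight (hf : f ∈ tightSpectrum G.powersetSpace.Idem) {z : G.powersetSpace.Idem}
    {F : Set G.FinPath} (hF : F.Finite) (hle : ∀ p ∈ F, G.pathIdem p ≤ z)
    (hcov : ∀ q, G.pathIdem q ≤ z → ∃ p ∈ F, ∃ k : G.FinPath,
      IsBeginning p (.fin k) ∧ IsBeginning q (.fin k))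
    (hz : f z = true) : ∃ p ∈ F, f (G.pathIdem p) = true := by
  classical
  have h := hf.2 z (hF.toFinset.image G.pathIdem) ⟨?_, ?_⟩
  · rw [hz, Finset.sup_image] at h
    by_contra! hn
    have h0 : hF.toFinset.sup (f ∘ G.pathIdem) = ⊥ :=
      (Finset.sup_eq_bot_iff _ _).2 fun p hp =>
        Bool.eq_false_of_not_eq_true (hn p (hF.mem_toFinset.1 hp))
    rw [h0] at h
    exact absurd h (by decide)
  · intro y hy
    simp only [Finset.coe_image, Set.Finite.coe_toFinset, Set.mem_image] at hy
    obtain ⟨p, hp, rfl⟩ := hy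
    exact hle p hp
  · intro y hy hne
    obtain ⟨q, hq⟩ := exists_pathIdem_le hne
    obtain ⟨p, hp, k, hk1, hk2⟩ := hcov q (hq.trans hy)
    -- The idempotent of the common extension `k` is a nonzero element below both `G.pathIdem p` and
    -- `y`.
    refine ⟨G.pathIdem p, by simpa using ⟨p, hp, rfl⟩, fun h0 => pathIdem_ne_bot k ?_⟩
    exact le_bot_iff.1 (h0 ▸ le_inf (pathIdem_le_pathIdem_iff.2 hk1)
      ((pathIdem_le_pathIdem_iff.2 hk2).trans hq))

/-- The representatives of `z` form a finite cover: any path idempotent below `z` belongs to a path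
that begins with one of them. -/
theorem tight_eq_true_iff [Finite V] (hf : f ∈ tightSpectrum G.powersetSpace.Idem)
    {z : G.powersetSpace.Idem} :
    f z = true ↔ ∃ p ∈ G.idemPaths z, f (G.pathIdem p) = true := by
  constructor
  · refine exists_of_tight hf (finite_idemPaths z) (fun p => pathIdem_le_of_mem) fun q hq => ?_
    obtain ⟨m, hm, h⟩ := pathIdem_le_iff.1 hq
    exact ⟨m, hm, q, h, IsBeginning.refl q⟩
  · rintro ⟨p, hp, h⟩
    exact character_mono hf.1 (pathIdem_le_of_mem hp) h

theorem exists_boundaryPath_of_tight [Finite V] (hf : f ∈ tightSpectrum G.powersetSpace.Idem) :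
    ∃ x ∈ G.boundaryPathSpace, ∀ m, IsBeginning m x ↔ f (G.pathIdem m) = true := by
  refine exists_boundaryPath (C := {m | f (G.pathIdem m) = true}) ?_ ?_ ?_ ?_
  · obtain ⟨z, hz⟩ := hf.1.nonzero
    obtain ⟨p, -, hp⟩ := (tight_eq_true_iff hf).1 (Bool.eq_true_of_not_eq_false hz)
    exact ⟨p, hp⟩
  · intro p hp m hm
    exact character_mono hf.1 (pathIdem_le_pathIdem_iff.2 hm) hp
  · intro p hp q hq
    have hp : f (G.pathIdem p) = true := hp
    have hq : f (G.pathIdem q) = true := hq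
    have h := hf.1.map_inf (G.pathIdem p) (G.pathIdem q)
    -- Both values are 1, so the meet has value 1 and is nonzero. A path idempotent below it comes
    -- from a common extension of `p` and `q`, which makes them comparable.
    have hne : G.pathIdem p ⊓ G.pathIdem q ≠ ⊥ := by
      intro h0
      rw [h0, hf.1.map_bot, hp, hq] at h
      exact absurd h (by decide)
    obtain ⟨k, hk⟩ := exists_pathIdem_le hne
    exact (pathIdem_le_pathIdem_iff.1 (hk.trans inf_le_left)).total
      (pathIdem_le_pathIdem_iff.1 (hk.trans inf_le_right))
  · intro p hp hs
    simp only [IsSingular, not_or, Set.not_infinite] at hs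
    obtain ⟨⟨e₀, he₀⟩, hfin⟩ := hs.imp_left Set.nonempty_iff_ne_empty.2
    have he₀ : G.source e₀ = p.range := he₀
    have hF : {q : G.FinPath | ∃ e he, q = p.snoc e he}.Finite := by
      have := hfin.to_subtype
      refine (Set.finite_range fun e : {e | G.source e = p.range} => p.snoc e.1 e.2).subset ?_
      rintro q ⟨e, he, rfl⟩
      exact ⟨⟨e, he⟩, rfl⟩
    have hle : ∀ q ∈ {q : G.FinPath | ∃ e he, q = p.snoc e he}, G.pathIdem q ≤ G.pathIdem p := by
      rintro q ⟨e, he, rfl⟩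
      exact pathIdem_le_pathIdem_iff.2 (p.isBeginning_snoc e he)
    -- The one-edge extensions cover `G.pathIdem p`: a proper extension of `p` begins with one of
    -- them, and `p` itself is compatible with the one by `e₀`, which exists since the range is not
    -- a sink.
    obtain ⟨q, ⟨e, he, rfl⟩, h⟩ := exists_of_tight hf hF hle (fun q hq => by
      rcases (pathIdem_le_pathIdem_iff.1 hq).eq_or_snoc with rfl | ⟨e, he, h⟩
      · exact ⟨_, ⟨e₀, he₀, rfl⟩, _, IsBeginning.refl _, p.isBeginning_snoc e₀ he₀⟩
      · exact ⟨_, ⟨e, he, rfl⟩, q, h, IsBeginning.refl q⟩) hp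
    exact ⟨e, he, h⟩

end TightCharacters

/-! ### The character of a boundary path -/

/-- Replacing representatives by path idempotents below `z` makes monotonicity in `z` immediate. -/
theorem pathCharacter_eq_true_iff_le {x : G.AnyPath} {z : G.powersetSpace.Idem} :
    pathCharacter x z = true ↔ ∃ m, G.pathIdem m ≤ z ∧ IsBeginning m x := by
  rw [pathCharacter_eq_true_iff]
  constructor
  · rintro ⟨m, hm, h⟩
    exact ⟨m, pathIdem_le_of_mem hm, h⟩
  · rintro ⟨m, hm, h⟩
    obtain ⟨k, hk, h'⟩ := pathIdem_le_iff.1 hm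
    exact ⟨k, hk, h'.trans h⟩

theorem pathCharacter_pathIdem (x : G.AnyPath) (m : G.FinPath) :
    pathCharacter x (G.pathIdem m) = beginnings x m := by
  simp [pathCharacter, beginnings, idemPaths_pathIdem]

theorem pathCharacter_mono (x : G.AnyPath) {y z : G.powersetSpace.Idem} (h : y ≤ z)
    (hy : pathCharacter x y = true) : pathCharacter x z = true := by
  rw [pathCharacter_eq_true_iff_le] at hy ⊢
  exact hy.imp fun m hm => ⟨hm.1.trans h, hm.2⟩

theorem isSemilatticeCharacter_pathCharacter (x : G.AnyPath) :
    IsSemilatticeCharacter (pathCharacter x) where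
  nonzero := by
    obtain ⟨m, hm⟩ := exists_isBeginning x
    refine ⟨G.pathIdem m, fun h => ?_⟩
    rw [pathCharacter_pathIdem] at h
    simp [beginnings, hm] at h
  map_bot := by
    refine Bool.eq_false_of_not_eq_true fun h => ?_
    obtain ⟨m, hm, -⟩ := pathCharacter_eq_true_iff_le.1 h
    exact pathIdem_ne_bot m (le_bot_iff.1 hm)
  map_inf y z := by
    rw [Bool.eq_iff_iff]
    change _ ↔ (_ && _) = true
    rw [Bool.and_eq_true]
    refine ⟨fun h => ⟨pathCharacter_mono x inf_le_left h, pathCharacter_mono x inf_le_right h⟩, ?_⟩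
    simp only [pathCharacter_eq_true_iff_le]
    rintro ⟨⟨m, hm, hmx⟩, k, hk, hkx⟩
    -- Of the two beginnings of `x`, the longer one has its idempotent below both `y` and `z`.
    rcases hmx.total hkx with h | h
    · exact ⟨k, le_inf ((pathIdem_le_pathIdem_iff.2 h).trans hm) hk, hkx⟩
    · exact ⟨m, le_inf hm ((pathIdem_le_pathIdem_iff.2 h).trans hk), hmx⟩

theorem pathCharacter_mem_tightSpectrum [Finite V] {x : G.AnyPath}
    (hx : x ∈ G.boundaryPathSpace) : pathCharacter x ∈ tightSpectrum G.powersetSpace.Idem := by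
  refine ⟨isSemilatticeCharacter_pathCharacter x, fun z Z hZ => ?_⟩
  refine le_antisymm (Finset.sup_le fun y hy => Bool.le_iff_imp.2 ?_) (Bool.le_iff_imp.2 ?_)
  · exact pathCharacter_mono x (hZ.1 hy)
  · intro hz
    obtain ⟨p, hpz, hp⟩ := pathCharacter_eq_true_iff_le.1 hz
    have hF : (⋃ y ∈ Z, G.idemPaths y).Finite :=
      Z.finite_toSet.biUnion fun y _ => finite_idemPaths y
    -- `q` need not be a beginning of `x`. It lies below `z`, so some `y` in the cover meets it; the
    -- representative of `y` compatible with `q` must, by the choice of `q`, be a beginning of `x`.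
    obtain ⟨q, hpq, hq⟩ := exists_extension_avoiding hx hp hF
    obtain ⟨y, hy, hne⟩ := hZ.2 (G.pathIdem q) ((pathIdem_le_pathIdem_iff.2 hpq).trans hpz)
      (pathIdem_ne_bot q)
    obtain ⟨k, hk⟩ := exists_pathIdem_le hne
    obtain ⟨m, hm, hmk⟩ := pathIdem_le_iff.1 (hk.trans inf_le_left)
    have hmx := hq m (Set.mem_biUnion hy hm) k hmk
      (pathIdem_le_pathIdem_iff.1 (hk.trans inf_le_right))
    have hyx : pathCharacter x y = true := pathCharacter_eq_true_iff.2 ⟨m, hm, hmx⟩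
    exact Bool.le_iff_imp.1 (Finset.le_sup (f := pathCharacter x) hy) hyx

/-! ### Comparison of the topologies and the homeomorphism -/

/-- The character of a path depends continuously on the path, and determines its topology. -/
theorem isInducing_pathCharacter [Finite V] :
    Topology.IsInducing (pathCharacter : G.AnyPath → G.powersetSpace.Idem → Bool) := by
  have hb : Topology.IsInducing (beginnings : G.AnyPath → G.FinPath → Bool) := ⟨rfl⟩
  have hr : Continuous fun (g : G.powersetSpace.Idem → Bool) (m : G.FinPath) =>
      g (G.pathIdem m) := by fun_prop
  -- Restricting a character to path idempotents gives back `beginnings`, which is inducing by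
  -- definition; only continuity of each coordinate remains.
  refine Topology.IsInducing.of_comp (continuous_pi fun z => ?_) hr ?_
  -- As `z` has finitely many representatives, this coordinate is a finite supremum of coordinates
  -- of `beginnings`.
  · have h : (fun x : G.AnyPath => pathCharacter x z) =
        fun x => (finite_idemPaths z).toFinset.sup (beginnings x) := by
      funext x
      rw [Bool.eq_iff_iff, pathCharacter_eq_true_iff]
      constructor
      · rintro ⟨m, hm, h⟩
        exact Bool.le_iff_imp.1 (Finset.le_sup (f := beginnings x)
          ((finite_idemPaths z).mem_toFinset.2 hm)) (by simpa [beginnings] using h)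
      · intro h
        by_contra! hn
        rw [(Finset.sup_eq_bot_iff _ _).2 fun m hm => ?_] at h
        · exact absurd h (by decide)
        · simpa [beginnings] using hn m ((finite_idemPaths z).mem_toFinset.1 hm)
    have : ContinuousSup Bool := ⟨continuous_of_discreteTopology⟩
    rw [h]
    exact Continuous.finset_sup_apply fun m _ => (continuous_apply m).comp hb.continuous
  · convert hb using 1
    funext x m
    exact pathCharacter_pathIdem x m

theorem pathCharacter_injective :
    Function.Injective (pathCharacter : G.AnyPath → G.powersetSpace.Idem → Bool) := by
  intro x y h
  refine AnyPath.ext_of_isBeginning fun m => ?_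
  have := congrFun h (G.pathIdem m)
  rw [pathCharacter_pathIdem, pathCharacter_pathIdem] at this
  simpa [beginnings] using this

theorem exists_pathCharacter_eq [Finite V] {f : G.powersetSpace.Idem → Bool}
    (hf : f ∈ tightSpectrum G.powersetSpace.Idem) :
    ∃ x ∈ G.boundaryPathSpace, pathCharacter x = f := by
  obtain ⟨x, hx, h⟩ := exists_boundaryPath_of_tight hf
  refine ⟨x, hx, funext fun z => ?_⟩
  rw [Bool.eq_iff_iff, pathCharacter_eq_true_iff, tight_eq_true_iff hf]
  simp only [h]

end LabelledGraph

theorem mainTheorem5 {V E L : Type*} [Finite V] (G : LabelledGraph V E L) [G.LeftResolving] :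
    Nonempty (tightSpectrum G.powersetSpace.Idem ≃ₜ G.boundaryPathSpace) := by
  let φ : G.boundaryPathSpace → tightSpectrum G.powersetSpace.Idem := fun x =>
    ⟨LabelledGraph.pathCharacter x.1, LabelledGraph.pathCharacter_mem_tightSpectrum x.2⟩
  have hφ : Function.Bijective φ := by
    refine ⟨fun x y h => Subtype.ext ?_, fun f => ?_⟩
    · exact LabelledGraph.pathCharacter_injective (congrArg Subtype.val h)
    · obtain ⟨x, hx, h⟩ := LabelledGraph.exists_pathCharacter_eq f.2
      exact ⟨⟨x, hx⟩, Subtype.ext h⟩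
  have hi : Topology.IsInducing φ :=
    (LabelledGraph.isInducing_pathCharacter.comp Topology.IsInducing.subtypeVal).codRestrict _
  exact ⟨((Equiv.ofBijective φ hφ).toHomeomorphOfIsInducing hi).symm⟩
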